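/- Let $N\ge 1$, and let $\hat{\mathcal G}(t)=(\{0,1,\dots,N\},\hat{\mathcal E}(t))$, $t\ge 0$, be a time-varying digraph without selfloops, where node $0$ (the exosystem) has no incoming edges and $(j,i)\in\hat{\mathcal E}(t)$ means that node $i$ receives information from node $j$ at time $t$. Let $a_{ij}(t)$ be weights, piecewise continuous and bounded on $[0,\infty)$, such that for some $\epsilon>0$ one has $a_{ij}(t)\ge\epsilon$ if $(j,i)\in\hat{\mathcal E}(t)$, and $a_{ij}(t)=0$ otherwise. Suppose that the edges have a positive dwell time: there is $\tau>0$ such that every edge present at a time $t\ge0$ is present throughout some interval $[s,s+\tau]\ni t$ with $s\ge 0$. Let $S_0\in\mathbb R^{r\times r}$ be a matrix all of whose (complex) eigenvalues have real part zero, let $w_0$ be a solution of $\dot w_0=S_0w_0$ on $[0,\infty)$, and consider the distributed exosystem generator, for $i=1,\dots,N$, $$\dot S_i(t)=\sum_{j=0}^N a_{ij}(t)\,(S_j(t)-S_i(t)),\qquad \dot w_i(t)=S_i(t)w_i(t)+\sum_{j=0}^N a_{ij}(t)\,(w_j(t)-w_i(t)),$$ where $S_i(t)\in\mathbb R^{r\times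 r}$, $w_i(t)\in\mathbb R^r$ and $S_0(t)\equiv S_0$; solutions are continuous functions on $[0,\infty)$ satisfying the equations at all but countably many times. Suppose that $\hat{\mathcal G}(t)$ uniformly contains a spanning tree with root $0$: there is $T>0$ such that for every $t\ge 0$ the union digraph $(\{0,\dots,N\},\bigcup_{s\in[t,t+T]}\hat{\mathcal E}(s))$ contains a directed spanning tree rooted at node $0$. Then, for all initial values $S_i(0)$, $w_i(0)$ ($i=1,\dots,N$) and $w_0(0)$, $$\lim_{t\to\infty}(S_i(t)-S_0)=0,\qquad \lim_{t\to\infty}(w_i(t)-w_0(t))=0\qquad (i=1,\dots,N).$$ -/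

import Mathlib

open Set Filter Topology

namespace ExoNet

/-- A real function on `[0, ∞)` is piecewise continuous: every bounded interval `[0, T]` contains
only finitely many discontinuities, and all one-sided limits exist (and are finite). -/
structure PiecewiseContinuous (f : ℝ → ℝ) : Prop where
  finite_discontinuities :
    ∀ T : ℝ, {t : ℝ | t ∈ Icc 0 T ∧ ¬ ContinuousWithinAt f (Ici 0) t}.Finite
  right_limit : ∀ t : ℝ, 0 ≤ t → ∃ l : ℝ, Tendsto f (𝓝[>] t) (𝓝 l)
  left_limit : ∀ t : ℝ, 0 < t → ∃ l : ℝ, Tendsto f (𝓝[<] t) (𝓝 l)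

/-- `x` solves `ẋ(t) = v(t)` on `[0, ∞)`, where `v` may have jumps: `x` is continuous on `[0, ∞)`
and the equation holds at all times `t > 0` outside a countable set. -/
def SolvesODE (x v : ℝ → ℝ) : Prop :=
  ContinuousOn x (Ici 0) ∧
    ∃ D : Set ℝ, D.Countable ∧ ∀ t : ℝ, 0 < t → t ∉ D → HasDerivAt x (v t) t

/-- The union digraph of the time-varying digraph `G` over the time interval `[t₁, t₂]`. -/
def unionDigraph {V : Type*} (G : ℝ → Digraph V) (t₁ t₂ : ℝ) : Digraph V where
  Adj j i := ∃ s ∈ Icc t₁ t₂, (G s).Adj j i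

/-- `H` is a directed tree on all of `V` with root `ρ`: the root has no parent, every other node has
exactly one parent, and every node can be reached from the root along directed edges. -/
structure IsDirectedTree {V : Type*} (H : Digraph V) (ρ : V) : Prop where
  root_no_parent : ∀ j : V, ¬ H.Adj j ρ
  unique_parent : ∀ i : V, i ≠ ρ → ∃! j : V, H.Adj j i
  reachable : ∀ i : V, Relation.ReflTransGen H.Adj ρ i

/-- The digraph `G` contains a spanning tree with root `ρ`. -/
def ContainsSpanningTree {V : Type*} (G : Digraph V) (ρ : V) : Prop :=
  ∃ H : Digraph V, (∀ j i : V, H.Adj j i → G.Adj j i) ∧ IsDirectedTree H ρ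

/-- The time-varying digraph `G` uniformly contains a spanning tree, with root `ρ`. -/
def UniformlyContainsSpanningTree {V : Type*} (G : ℝ → Digraph V) (ρ : V) : Prop :=
  ∃ T : ℝ, 0 < T ∧ ∀ t : ℝ, 0 ≤ t → ContainsSpanningTree (unionDigraph G t (t + T)) ρ

/-- Dwell time: there is `τ > 0` such that an edge present at some time `t ≥ 0` is present throughout
some time interval of length `τ` containing `t`. -/
def HasDwellTime {V : Type*} (G : ℝ → Digraph V) : Prop :=
  ∃ τ : ℝ, 0 < τ ∧ ∀ t : ℝ, 0 ≤ t → ∀ j i : V, (G t).Adj j i →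
    ∃ s : ℝ, 0 ≤ s ∧ t ∈ Icc s (s + τ) ∧ ∀ u ∈ Icc s (s + τ), (G u).Adj j i

/-- `G` is a communication digraph on the nodes `0, 1, …, N` (node `0` is the exosystem) with
communication weights `a t i j = a_{ij}(t)`. An edge `(j, i)` means that `i` receives information
from `j`; there are no selfloops and the exosystem receives no information. -/
structure IsCommunicationNetwork {N : ℕ} (G : ℝ → Digraph (Fin (N + 1)))
    (a : ℝ → Fin (N + 1) → Fin (N + 1) → ℝ) : Prop where
  no_selfloop : ∀ t : ℝ, 0 ≤ t → ∀ i, ¬ (G t).Adj i i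
  exosystem_no_input : ∀ t : ℝ, 0 ≤ t → ∀ j, ¬ (G t).Adj j 0
  weight_lower_bound : ∃ ε : ℝ, 0 < ε ∧
    ∀ t : ℝ, 0 ≤ t → ∀ i j, (G t).Adj j i → ε ≤ a t i j
  weight_eq_zero : ∀ t : ℝ, 0 ≤ t → ∀ i j, ¬ (G t).Adj j i → a t i j = 0
  piecewise_continuous : ∀ i j, PiecewiseContinuous (fun t => a t i j)
  bounded : ∃ C : ℝ, ∀ t : ℝ, 0 ≤ t → ∀ i j, a t i j ≤ C

/-- `(S i, w i)`, `i = 0, …, N`, is a trajectory on `[0, ∞)` of the exosystem `ẇ₀ = S₀ w₀` (node `0`,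
with the constant matrix `S₀`) together with the distributed exosystem generator of the agents
`i ≠ 0`. The matrix and vector differential equations are written out entrywise. -/
structure IsExosystemGeneratorTrajectory {N r : ℕ}
    (a : ℝ → Fin (N + 1) → Fin (N + 1) → ℝ) (S₀ : Matrix (Fin r) (Fin r) ℝ)
    (S : Fin (N + 1) → ℝ → Matrix (Fin r) (Fin r) ℝ)
    (w : Fin (N + 1) → ℝ → Fin r → ℝ) : Prop where
  exosystem_S : ∀ t : ℝ, 0 ≤ t → S 0 t = S₀
  exosystem_w : ∀ t : ℝ, 0 ≤ t →
    HasDerivWithinAt (w 0) (S₀.mulVec (w 0 t)) (Ici 0) t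
  agent_S : ∀ i, i ≠ 0 → ∀ p q, SolvesODE (fun t => S i t p q)
    (fun t => (∑ j, a t i j • (S j t - S i t)) p q)
  agent_w : ∀ i, i ≠ 0 → ∀ p, SolvesODE (fun t => w i t p)
    (fun t => ((S i t).mulVec (w i t) + ∑ j, a t i j • (w j t - w i t)) p)

end ExoNet

/-! The engine is a quantitative form of leader-following consensus for scalars. If the followers
lie below `M` and the root is at `0`, the gaps `M - x_i` are nonnegative, satisfy `ẏ_i ≥ ∑ a_ij (y_j
- y_i)`, and equal `M` at the root. Within a bounded time window some edge carries a definite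
fraction of this gap to a node not yet reached, and nodes already reached lose at most a fixed
factor. After finitely many windows every gap is at least `η M` (`exists_uniform_lower_bound`).
Applied to `x` and `-x`, this contracts `max |x_i|` by `1 - η` in a fixed time
(`exists_contraction`), even with a bounded input, so consensus converges exponentially and
tolerates an exponentially vanishing linear perturbation
(`exists_exp_decay_of_perturbed_consensus`).

Each entry of `S i - S₀` obeys the unperturbed protocol, hence decays exponentially. In the frame `z
i = exp(-t S₀) w i` the exosystem is constant and the coupling, having scalar weights, is unchanged;
what remains is the perturbation `exp(-t S₀) (S i - S₀) exp(t S₀) z i`. Since the spectrum of `S₀`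
is imaginary, both exponentials grow slower than any `exp(ε t)` (`exists_norm_exp_smul_le`), so the
perturbation still vanishes exponentially, and so does the error after returning to the original
frame. -/

namespace ExoNet

/-! ### Minimum and comparison principles off a countable set -/

section MinimumPrinciple

/-- A minimum principle for finitely many continuous functions which are differentiable off a
countable set: if the smallest function increases strictly whenever it lies below `m`, then the
functions stay above `m`. -/
theorem le_of_minimum_strictly_increasing {ι : Type*} [Finite ι] {h : ι → ℝ → ℝ} {D : Set ℝ}
    {a b m : ℝ} (hab : a ≤ b) (hD : D.Countable) (hc : ∀ i, ContinuousOn (h i) (Icc a b))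
    (ha : ∀ i, m ≤ h i a)
    (hder : ∀ s ∈ Ioo a b, s ∉ D → ∀ i, h i s < m → (∀ j, h i s ≤ h j s) →
      ∃ v, 0 < v ∧ HasDerivAt (h i) v s) (i : ι) : m ≤ h i b := by
  by_contra! hlt
  have hcount : (⋃ j, h j '' D).Countable := countable_iUnion fun j => hD.image _
  -- A level `c` that no function takes at an exceptional time: the first time some function reaches
  -- `c` is then a point of differentiability.
  obtain ⟨c, hcI, hcD⟩ : ∃ c ∈ Ioo (h i b) m, c ∉ ⋃ j, h j '' D := by
    by_contra! hcon
    have := (Cardinal.mk_Ioo_real hlt).symm.trans_le (hcount.mono hcon).le_aleph0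
    exact absurd this (not_le.2 Cardinal.aleph0_lt_continuum)
  let Z : Set ℝ := ⋃ j, Icc a b ∩ h j ⁻¹' Iic c
  have hZc : IsClosed Z :=
    isClosed_iUnion_of_finite fun j => (hc j).preimage_isClosed_of_isClosed isClosed_Icc isClosed_Iic
  have hbZ : b ∈ Z := mem_iUnion.2 ⟨i, ⟨hab, le_rfl⟩, hcI.1.le⟩
  have hZb : BddBelow Z := ⟨a, fun x hx => by
    obtain ⟨j, hj⟩ := mem_iUnion.1 hx; exact hj.1.1⟩
  obtain ⟨k, hk, hkc⟩ := mem_iUnion.1 (hZc.csInf_mem ⟨b, hbZ⟩ hZb)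
  set s := sInf Z
  have hkc : h k s ≤ c := hkc
  have has : a < s := lt_of_le_of_ne hk.1 fun e => by
    have := ha k; rw [e] at this; linarith [hcI.2]
  have hbefore : ∀ j, ∀ x ∈ Ico a s, c < h j x := fun j x hx => by
    by_contra! hle
    have : x ∈ Z := mem_iUnion.2 ⟨j, ⟨hx.1, hx.2.le.trans hk.2⟩, hle⟩
    exact absurd (csInf_le hZb this) (not_le.2 hx.2)
  have hge : ∀ j, c ≤ h j s := fun j => by
    have hcs : ContinuousWithinAt (h j) (Ico a s) s :=
      ((hc j) s hk).mono fun x hx => ⟨hx.1, hx.2.le.trans hk.2⟩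
    have hne : (𝓝[Ico a s] s).NeBot := by
      rw [← mem_closure_iff_nhdsWithin_neBot, closure_Ico has.ne]
      exact ⟨has.le, le_rfl⟩
    exact ge_of_tendsto hcs (eventually_mem_nhdsWithin.mono fun x hx => (hbefore j x hx).le)
  have hks : h k s = c := le_antisymm hkc (hge k)
  have hsb : s < b := lt_of_le_of_ne hk.2 fun e => by
    have := hge i; rw [e] at this; linarith [hcI.1]
  have hsD : s ∉ D := fun hs => hcD (mem_iUnion.2 ⟨k, s, hs, hks⟩)
  obtain ⟨v, hv, hd⟩ := hder s ⟨has, hsb⟩ hsD k (hks ▸ hcI.2) fun j => hks ▸ hge j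
  -- All functions exceed `c` before `s`, so left slopes at `s` are nonpositive, contradicting `0 <
  -- v`.
  have hslope := (hasDerivAt_iff_tendsto_slope_left_right.1 hd).1
  have : v ≤ 0 := by
    refine le_of_tendsto hslope ?_
    filter_upwards [Ioo_mem_nhdsLT has] with x hx
    rw [slope_def_field]
    have := hbefore k x ⟨hx.1.le, hx.2⟩
    exact div_nonpos_of_nonneg_of_nonpos (by linarith) (by linarith [hx.2])
  linarith

/-- A continuous function whose derivative is nonnegative off a countable set is monotone. -/
theorem le_of_hasDerivAt_nonneg_off_countable {g g' : ℝ → ℝ} {D : Set ℝ} {a b : ℝ} (hab : a ≤ b)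
    (hD : D.Countable) (hc : ContinuousOn g (Icc a b))
    (hd : ∀ s ∈ Ioo a b, s ∉ D → HasDerivAt g (g' s) s)
    (hn : ∀ s ∈ Ioo a b, s ∉ D → 0 ≤ g' s) :
    g a ≤ g b := by
  refine le_of_forall_pos_le_add fun δ hδ => ?_
  -- A small tilt makes the derivative strictly positive; the `+ 1` covers `a = b`.
  have hpos : 0 < δ / (b - a + 1) := div_pos hδ (by linarith)
  have key := le_of_minimum_strictly_increasing (ι := Unit) (m := g a)
    (h := fun _ s => g s + δ / (b - a + 1) * (s - a)) hab hD
    (fun _ => hc.add (by fun_prop)) (fun _ => by simp)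
    (fun s hs hsD _ _ _ => ⟨g' s + δ / (b - a + 1) * 1, by linarith [hn s hs hsD],
      (hd s hs hsD).add (((hasDerivAt_id s).sub_const a).const_mul _)⟩) ()
  have : δ / (b - a + 1) * (b - a) ≤ δ := by
    rw [div_mul_eq_mul_div, div_le_iff₀ (by linarith)]; nlinarith
  linarith

/-- Comparison with the linear equation `ẏ = p - B y`. -/
theorem linear_comparison {y v : ℝ → ℝ} {D : Set ℝ} {a b B p : ℝ} (hab : a ≤ b)
    (hD : D.Countable) (hc : ContinuousOn y (Icc a b)) (hB : 0 < B)
    (hd : ∀ s ∈ Ioo a b, s ∉ D → HasDerivAt y (v s) s)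
    (hn : ∀ s ∈ Ioo a b, s ∉ D → p - B * y s ≤ v s) :
    Real.exp (-(B * (b - a))) * y a + p / B * (1 - Real.exp (-(B * (b - a)))) ≤ y b := by
  -- Integrating factor, normalized to be `1` at `b`, applied to the deviation from the equilibrium
  -- `p / B`.
  have key := le_of_hasDerivAt_nonneg_off_countable (a := a) (b := b) (D := D)
    (g := fun s => Real.exp (B * (s - b)) * (y s - p / B))
    (g' := fun s => Real.exp (B * (s - b)) * B * (y s - p / B) +
      Real.exp (B * (s - b)) * v s) hab hD
    (ContinuousOn.mul (by fun_prop) (hc.sub continuousOn_const))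
    (fun s hs hsD => by
      have h1 : HasDerivAt (fun s => Real.exp (B * (s - b))) (Real.exp (B * (s - b)) * B) s := by
        simpa using (((hasDerivAt_id s).sub_const b).const_mul B).exp
      exact h1.mul ((hd s hs hsD).sub_const (p / B)))
    (fun s hs hsD => by
      have e : Real.exp (B * (s - b)) * B * (y s - p / B) + Real.exp (B * (s - b)) * v s =
        Real.exp (B * (s - b)) * (v s - (p - B * y s)) := by field_simp; ring
      rw [e]
      exact mul_nonneg (Real.exp_pos _).le (by linarith [hn s hs hsD]))
  simp only [sub_self, mul_zero, Real.exp_zero, one_mul] at key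
  have e : B * (a - b) = -(B * (b - a)) := by ring
  rw [e] at key
  linarith

/-- Otherwise induction along tree paths from the root would never leave `A`. -/
theorem ContainsSpanningTree.exists_edge_leaving {V : Type*} {H : Digraph V} {ρ : V}
    (hH : ContainsSpanningTree H ρ) {A : Set V} (hρ : ρ ∈ A) (hA : A ≠ univ) :
    ∃ j ∈ A, ∃ i ∉ A, H.Adj j i := by
  obtain ⟨K, hKH, hK⟩ := hH
  by_contra! hcon
  refine hA (eq_univ_of_forall fun i => ?_)
  induction hK.reachable i with
  | refl => exact hρ
  | @tail j k _ hjk hj => by_contra hk; exact hcon j hj k hk (hKH _ _ hjk)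

end MinimumPrinciple

/-! ### Propagation of lower bounds through the network -/

section Supersolution

variable {N : ℕ}

theorem IsCommunicationNetwork.weight_nonneg {G : ℝ → Digraph (Fin (N + 1))}
    {a : ℝ → Fin (N + 1) → Fin (N + 1) → ℝ} (hnet : IsCommunicationNetwork G a) {t : ℝ}
    (ht : 0 ≤ t) (i j : Fin (N + 1)) : 0 ≤ a t i j := by
  obtain ⟨ε, hε, h⟩ := hnet.weight_lower_bound
  by_cases hij : (G t).Adj j i
  · exact hε.le.trans (h t ht i j hij)
  · exact (hnet.weight_eq_zero t ht i j hij).ge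

theorem IsCommunicationNetwork.exists_sum_weight_le {G : ℝ → Digraph (Fin (N + 1))}
    {a : ℝ → Fin (N + 1) → Fin (N + 1) → ℝ} (hnet : IsCommunicationNetwork G a) :
    ∃ B : ℝ, 0 < B ∧ ∀ t, 0 ≤ t → ∀ i, ∑ j, a t i j ≤ B := by
  obtain ⟨C, hC⟩ := hnet.bounded
  refine ⟨(N + 1) * |C| + 1, by positivity, fun t ht i => ?_⟩
  calc ∑ j, a t i j ≤ ∑ _j : Fin (N + 1), |C| :=
        Finset.sum_le_sum fun j _ => (hC t ht i j).trans (le_abs_self C)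
    _ ≤ (N + 1) * |C| + 1 := by simp

/-- `y` satisfies the differential inequalities `ẏ_i ≥ ∑ j, a_{ij} (y_j - y_i)`, `i ≠ 0`, on
`[t₀, t₁]`, off the countable set `D`. -/
structure IsSupersolution (a : ℝ → Fin (N + 1) → Fin (N + 1) → ℝ) (y : Fin (N + 1) → ℝ → ℝ)
    (D : Set ℝ) (t₀ t₁ : ℝ) : Prop where
  countable : D.Countable
  continuousOn : ∀ i, ContinuousOn (y i) (Icc t₀ t₁)
  differentiableAt : ∀ i, i ≠ 0 → ∀ s ∈ Ioo t₀ t₁, s ∉ D → DifferentiableAt ℝ (y i) s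
  le_deriv : ∀ i, i ≠ 0 → ∀ s ∈ Ioo t₀ t₁, s ∉ D →
    ∑ j, a s i j * (y j s - y i s) ≤ deriv (y i) s

namespace IsSupersolution

variable {a : ℝ → Fin (N + 1) → Fin (N + 1) → ℝ} {y : Fin (N + 1) → ℝ → ℝ} {D : Set ℝ}
  {t₀ t₁ : ℝ}

theorem mono (h : IsSupersolution a y D t₀ t₁) {s₀ s₁ : ℝ} (h₀ : t₀ ≤ s₀) (h₁ : s₁ ≤ t₁) :
    IsSupersolution a y D s₀ s₁ where
  countable := h.countable
  continuousOn i := (h.continuousOn i).mono (Icc_subset_Icc h₀ h₁)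
  differentiableAt i hi s hs := h.differentiableAt i hi s (Ioo_subset_Ioo h₀ h₁ hs)
  le_deriv i hi s hs := h.le_deriv i hi s (Ioo_subset_Ioo h₀ h₁ hs)

/-- At the smallest node all coupling terms are nonnegative, so after adding `δ (s - t₀)` the
minimum strictly increases; the root is never the smallest node while the minimum is negative. -/
theorem nonneg (h : IsSupersolution a y D t₀ t₁) (ha : ∀ s ∈ Ioo t₀ t₁, ∀ i j, 0 ≤ a s i j)
    (hroot : ∀ s ∈ Icc t₀ t₁, 0 ≤ y 0 s) (hinit : ∀ i, 0 ≤ y i t₀) {t : ℝ} (ht : t ∈ Icc t₀ t₁)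
    (i : Fin (N + 1)) : 0 ≤ y i t := by
  have key : ∀ δ : ℝ, 0 < δ → 0 ≤ y i t + δ * (t - t₀) := fun δ hδ =>
    le_of_minimum_strictly_increasing (h := fun i s => y i s + δ * (s - t₀)) ht.1 h.countable
      (fun j => ((h.continuousOn j).mono (Icc_subset_Icc_right ht.2)).add (by fun_prop))
      (fun j => by simpa using hinit j)
      (fun s hs hsD k hneg hmin => by
        have hs' : s ∈ Ioo t₀ t₁ := ⟨hs.1, hs.2.trans_le ht.2⟩
        have hk : k ≠ 0 := by
          rintro rfl
          have h1 := hroot s (Ioo_subset_Icc_self hs')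
          have h2 : 0 ≤ δ * (s - t₀) := mul_nonneg hδ.le (by linarith [hs.1])
          linarith
        refine ⟨deriv (y k) s + δ * 1, ?_, (h.differentiableAt k hk s hs' hsD).hasDerivAt.add
          (((hasDerivAt_id s).sub_const t₀).const_mul δ)⟩
        have : 0 ≤ ∑ j, a s k j * (y j s - y k s) := Finset.sum_nonneg fun j _ =>
          mul_nonneg (ha s hs' k j) (by linarith [hmin j])
        linarith [h.le_deriv k hk s hs' hsD]) i
  refine le_of_forall_pos_le_add fun δ hδ => ?_
  have hpos : 0 < t - t₀ + 1 := by linarith [ht.1]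
  have := key (δ / (t - t₀ + 1)) (div_pos hδ hpos)
  have : δ / (t - t₀ + 1) * (t - t₀) ≤ δ := by
    rw [div_mul_eq_mul_div, div_le_iff₀ hpos]; nlinarith
  linarith

/-- Splitting off the outflow, `y i ≥ 0` gives `ẏ_i ≥ p - B y_i`, where `p` bounds the inflow from
below. -/
theorem lower_bound (h : IsSupersolution a y D t₀ t₁) (h01 : t₀ ≤ t₁) {B p : ℝ} (hB : 0 < B)
    {i : Fin (N + 1)} (hi : i ≠ 0) (ha : ∀ s ∈ Ioo t₀ t₁, ∑ j, a s i j ≤ B)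
    (hy : ∀ s ∈ Ioo t₀ t₁, 0 ≤ y i s) (hp : ∀ s ∈ Ioo t₀ t₁, p ≤ ∑ j, a s i j * y j s) :
    Real.exp (-(B * (t₁ - t₀))) * y i t₀ + p / B * (1 - Real.exp (-(B * (t₁ - t₀)))) ≤ y i t₁ := by
  refine linear_comparison (v := deriv (y i)) h01 h.countable (h.continuousOn i) hB
    (fun s hs hsD => (h.differentiableAt i hi s hs hsD).hasDerivAt) fun s hs hsD => ?_
  have h1 := h.le_deriv i hi s hs hsD
  have h2 : ∑ j, a s i j * (y j s - y i s) = ∑ j, a s i j * y j s - (∑ j, a s i j) * y i s := by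
    rw [Finset.sum_mul, ← Finset.sum_sub_distrib]
    exact Finset.sum_congr rfl fun j _ => by ring
  have := mul_le_mul_of_nonneg_right (ha s hs) (hy s hs)
  linarith [hp s hs]

/-- A nonnegative supersolution decays at most exponentially. -/
theorem exp_mul_le (h : IsSupersolution a y D t₀ t₁) (h01 : t₀ ≤ t₁) {B : ℝ} (hB : 0 < B)
    {i : Fin (N + 1)} (hi : i ≠ 0) (ha : ∀ s ∈ Ioo t₀ t₁, ∑ j, a s i j ≤ B)
    (ha0 : ∀ s ∈ Ioo t₀ t₁, ∀ j, 0 ≤ a s i j) (hy : ∀ s ∈ Ioo t₀ t₁, ∀ j, 0 ≤ y j s) :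
    Real.exp (-(B * (t₁ - t₀))) * y i t₀ ≤ y i t₁ := by
  simpa using h.lower_bound h01 hB hi ha (fun s hs => hy s hs i) (p := 0) fun s hs =>
    Finset.sum_nonneg fun j _ => mul_nonneg (ha0 s hs j) (hy s hs j)

end IsSupersolution

variable {G : ℝ → Digraph (Fin (N + 1))} {a : ℝ → Fin (N + 1) → Fin (N + 1) → ℝ}

/-- Over a window of fixed length, the set of nodes where a nonnegative supersolution is large
grows along an edge. -/
theorem exists_window_growth (hnet : IsCommunicationNetwork G a) (hdwell : HasDwellTime G)
    (htree : UniformlyContainsSpanningTree G 0) :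
    ∃ Δ : ℝ, 0 < Δ ∧ ∃ θ : ℝ, 0 < θ ∧ θ ≤ 1 ∧ ∀ (y : Fin (N + 1) → ℝ → ℝ) (D : Set ℝ) (u m : ℝ),
      0 ≤ u → 0 ≤ m → IsSupersolution a y D u (u + Δ) →
      (∀ s ∈ Icc u (u + Δ), ∀ i, 0 ≤ y i s) → (∀ s ∈ Icc u (u + Δ), m ≤ y 0 s) →
      ∀ A : Finset (Fin (N + 1)), 0 ∈ A → (∀ i ∈ A, m ≤ y i u) →
      ∃ A' : Finset (Fin (N + 1)), 0 ∈ A' ∧ min (A.card + 1) (N + 1) ≤ A'.card ∧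
        ∀ i ∈ A', θ * m ≤ y i (u + Δ) := by
  obtain ⟨B, hB, hsum⟩ := hnet.exists_sum_weight_le
  obtain ⟨ε, hε, hlow⟩ := hnet.weight_lower_bound
  obtain ⟨τ, hτ, hdw⟩ := hdwell
  obtain ⟨T, hT, htr⟩ := htree
  -- A margin `τ` on each side of the tree window keeps the whole dwell interval of the chosen edge
  -- inside `[u, u + Δ]`.
  set Δ := T + 2 * τ with hΔ
  have hΔ0 : 0 < Δ := by positivity
  set κ := Real.exp (-(B * Δ)) with hκ
  have hκ0 : 0 < κ := Real.exp_pos _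
  have hκ1 : κ ≤ 1 := Real.exp_le_one_iff.2 (by nlinarith)
  -- `κ` is the worst loss over the window; `g m` is what a node gains during time `τ` from a
  -- neighbour staying above `κ m`.
  set g := ε * κ / B * (1 - Real.exp (-(B * τ))) with hg
  have hg0 : 0 < g := by
    have : Real.exp (-(B * τ)) < 1 := Real.exp_lt_one_iff.2 (by nlinarith)
    exact mul_pos (by positivity) (by linarith)
  refine ⟨Δ, hΔ0, κ * min 1 g, mul_pos hκ0 (lt_min one_pos hg0),
    mul_le_one₀ hκ1 (lt_min one_pos hg0).le (min_le_left _ _), ?_⟩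
  intro y D u m hu hm hy hnn hroot A h0A hA
  have hθ1 : κ * min 1 g * m ≤ κ * m := by
    have := mul_le_mul_of_nonneg_left (min_le_left 1 g) hκ0.le
    nlinarith
  have hdecay : ∀ i, i ≠ 0 → ∀ s s', u ≤ s → s ≤ s' → s' ≤ u + Δ → κ * y i s ≤ y i s' := by
    intro i hi s s' h1 h2 h3
    have hsub : Ioo s s' ⊆ Icc u (u + Δ) := fun x hx => ⟨h1.trans hx.1.le, hx.2.le.trans h3⟩
    have := (hy.mono h1 h3).exp_mul_le h2 hB hi
      (fun x hx => hsum x (hu.trans (hsub hx).1) i)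
      (fun x hx => hnet.weight_nonneg (hu.trans (hsub hx).1) i) (fun x hx => hnn x (hsub hx))
    refine le_trans (mul_le_mul_of_nonneg_right (Real.exp_le_exp.2 ?_)
      (hnn s ⟨h1, h2.trans h3⟩ i)) this
    nlinarith
  have hAs : ∀ i ∈ A, ∀ s ∈ Icc u (u + Δ), κ * m ≤ y i s := by
    intro i hi s hs
    by_cases h : i = 0
    · subst h; exact (mul_le_of_le_one_left hm hκ1).trans (hroot s hs)
    · exact (mul_le_mul_of_nonneg_left (hA i hi) hκ0.le).trans (hdecay i h u s le_rfl hs.1 hs.2)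
  have hend : ∀ i ∈ A, κ * min 1 g * m ≤ y i (u + Δ) := fun i hi =>
    hθ1.trans (hAs i hi _ ⟨by linarith, le_rfl⟩)
  by_cases hAu : A = Finset.univ
  · exact ⟨A, h0A, by rw [hAu]; simp, hend⟩
  · obtain ⟨j, hjA, i, hiA, t, ht, hji⟩ := (htr (u + τ) (by linarith)).exists_edge_leaving
      (A := (A : Set (Fin (N + 1)))) (by simpa using h0A) (by simpa using hAu)
    have hi0 : i ≠ 0 := by rintro rfl; exact hiA (by simpa using h0A)
    obtain ⟨s, hs, hts, hact⟩ := hdw t (by linarith [ht.1]) j i hji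
    have hs1 : u ≤ s := by linarith [hts.2, ht.1]
    have hs2 : s + τ ≤ u + Δ := by linarith [hts.1, ht.2]
    have hsub : Ioo s (s + τ) ⊆ Icc u (u + Δ) := fun x hx =>
      ⟨hs1.trans hx.1.le, hx.2.le.trans hs2⟩
    have hlb := (hy.mono hs1 hs2).lower_bound (by linarith) hB hi0 (p := ε * (κ * m))
      (fun x hx => hsum x (hu.trans (hsub hx).1) i) (fun x hx => hnn x (hsub hx) i)
      (fun x hx => by
        have hx0 := hu.trans (hsub hx).1
        calc ε * (κ * m) ≤ a x i j * y j x :=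
              mul_le_mul (hlow x hx0 i j (hact x (Ioo_subset_Icc_self hx)))
                (hAs j hjA x (hsub hx)) (by positivity) (hnet.weight_nonneg hx0 i j)
          _ ≤ ∑ k, a x i k * y k x := Finset.single_le_sum (f := fun k => a x i k * y k x)
              (fun k _ => mul_nonneg (hnet.weight_nonneg hx0 i k) (hnn x (hsub hx) k))
              (Finset.mem_univ j))
    have hgm : g * m ≤ y i (s + τ) := by
      have h1 : 0 ≤ Real.exp (-(B * (s + τ - s))) * y i s :=
        mul_nonneg (Real.exp_pos _).le (hnn s ⟨hs1, by linarith⟩ i)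
      have h2 : s + τ - s = τ := by ring
      rw [h2] at hlb h1
      have h3 : g * m = ε * (κ * m) / B * (1 - Real.exp (-(B * τ))) := by rw [hg]; ring
      linarith
    have hiend : κ * min 1 g * m ≤ y i (u + Δ) := by
      have h1 := hdecay i hi0 (s + τ) (u + Δ) (by linarith) hs2 le_rfl
      have h2 : min 1 g * m ≤ y i (s + τ) :=
        (mul_le_mul_of_nonneg_right (min_le_right 1 g) hm).trans hgm
      have := mul_le_mul_of_nonneg_left h2 hκ0.le
      linarith
    refine ⟨insert i A, Finset.mem_insert_of_mem h0A, ?_, fun k hk => ?_⟩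
    · rw [Finset.card_insert_of_notMem (by simpa using hiA)]; exact min_le_left _ _
    · rcases Finset.mem_insert.1 hk with rfl | hk
      · exact hiend
      · exact hend k hk

/-- After a fixed time, all nodes have received a fixed fraction of the root's lower bound. -/
theorem exists_uniform_lower_bound (hnet : IsCommunicationNetwork G a) (hdwell : HasDwellTime G)
    (htree : UniformlyContainsSpanningTree G 0) :
    ∃ L : ℝ, 0 < L ∧ ∃ η : ℝ, 0 < η ∧ η ≤ 1 ∧ ∀ (y : Fin (N + 1) → ℝ → ℝ) (D : Set ℝ) (t₀ m : ℝ),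
      0 ≤ t₀ → 0 ≤ m → IsSupersolution a y D t₀ (t₀ + L) →
      (∀ s ∈ Icc t₀ (t₀ + L), m ≤ y 0 s) → (∀ i, 0 ≤ y i t₀) →
      (∀ s ∈ Icc t₀ (t₀ + L), ∀ i, 0 ≤ y i s) ∧ ∀ i, η * m ≤ y i (t₀ + L) := by
  obtain ⟨Δ, hΔ, θ, hθ, hθ1, hgrow⟩ := exists_window_growth hnet hdwell htree
  -- Starting from `{0}`, `N` windows already reach every node; one more keeps `L > 0` when `N = 0`.
  refine ⟨(N + 1) * Δ, by positivity, θ ^ (N + 1), by positivity, pow_le_one₀ hθ.le hθ1, ?_⟩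
  intro y D t₀ m ht₀ hm hy hroot hinit
  have hnn : ∀ s ∈ Icc t₀ (t₀ + (N + 1) * Δ), ∀ i, 0 ≤ y i s := fun s hs i =>
    hy.nonneg (fun x hx => hnet.weight_nonneg (ht₀.trans hx.1.le))
      (fun x hx => hm.trans (hroot x hx)) hinit hs i
  refine ⟨hnn, ?_⟩
  have key : ∀ k : ℕ, k ≤ N + 1 → ∃ A : Finset (Fin (N + 1)), 0 ∈ A ∧
      min (k + 1) (N + 1) ≤ A.card ∧ ∀ i ∈ A, θ ^ k * m ≤ y i (t₀ + k * Δ) := by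
    intro k
    induction k with
    | zero =>
      intro _
      refine ⟨{0}, by simp, by simp, fun i hi => ?_⟩
      rw [Finset.mem_singleton.1 hi]
      simpa using hroot t₀ ⟨le_rfl, by simp; positivity⟩
    | succ k ih =>
      intro hk
      obtain ⟨A, h0A, hcard, hA⟩ := ih (by omega)
      have hkN : ((k : ℝ) + 1) * Δ ≤ (N + 1) * Δ := by
        have : (k : ℝ) + 1 ≤ N + 1 := by exact_mod_cast hk
        exact mul_le_mul_of_nonneg_right this hΔ.le
      have hk0 : 0 ≤ (k : ℝ) * Δ := by positivity
      have hsub : Icc (t₀ + k * Δ) (t₀ + k * Δ + Δ) ⊆ Icc t₀ (t₀ + (N + 1) * Δ) :=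
        Icc_subset_Icc (by linarith) (by linarith)
      obtain ⟨A', h0', hcard', hA'⟩ := hgrow y D (t₀ + k * Δ) (θ ^ k * m) (by positivity)
        (by positivity) (hy.mono (by linarith) (by linarith)) (fun s hs => hnn s (hsub hs))
        (fun s hs => (mul_le_of_le_one_left hm (pow_le_one₀ hθ.le hθ1)).trans (hroot s (hsub hs)))
        A h0A hA
      refine ⟨A', h0', by omega, fun i hi => ?_⟩
      have := hA' i hi
      have e : t₀ + ((k + 1 : ℕ) : ℝ) * Δ = t₀ + k * Δ + Δ := by push_cast; ring
      rw [e, pow_succ]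
      linarith
  obtain ⟨A, -, hcard, hA⟩ := key (N + 1) le_rfl
  have hAu : A = Finset.univ := Finset.eq_univ_of_card A (le_antisymm
    (Finset.card_le_univ A) (by simpa using hcard))
  intro i
  simpa using hA i (hAu ▸ Finset.mem_univ i)

end Supersolution

/-! ### Contraction and robust exponential consensus -/

section Contraction

variable {N : ℕ} {G : ℝ → Digraph (Fin (N + 1))} {a : ℝ → Fin (N + 1) → Fin (N + 1) → ℝ}

/-- Contraction of the distance to the root, over a fixed time, for the scalar leader-following
consensus protocol with a bounded input. -/
theorem exists_contraction (hnet : IsCommunicationNetwork G a) (hdwell : HasDwellTime G)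
    (htree : UniformlyContainsSpanningTree G 0) :
    ∃ L : ℝ, 0 < L ∧ ∃ η : ℝ, 0 < η ∧ η ≤ 1 ∧ ∀ (x f : Fin (N + 1) → ℝ → ℝ) (D : Set ℝ)
      (t₀ M φ : ℝ), 0 ≤ t₀ → 0 ≤ M → 0 ≤ φ → D.Countable →
      (∀ i, ContinuousOn (x i) (Icc t₀ (t₀ + L))) →
      (∀ i, i ≠ 0 → ∀ s ∈ Ioo t₀ (t₀ + L), s ∉ D →
        HasDerivAt (x i) (∑ j, a s i j * (x j s - x i s) + f i s) s) →
      (∀ i, ∀ s ∈ Ioo t₀ (t₀ + L), |f i s| ≤ φ) →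
      (∀ s ∈ Icc t₀ (t₀ + L), x 0 s = 0) → (∀ i, |x i t₀| ≤ M) →
      (∀ s ∈ Icc t₀ (t₀ + L), ∀ i, |x i s| ≤ M + φ * (s - t₀)) ∧
        ∀ i, |x i (t₀ + L)| ≤ (1 - η) * M + φ * L := by
  obtain ⟨L, hL, η, hη, hη1, hlow⟩ := exists_uniform_lower_bound hnet hdwell htree
  have upper : ∀ (x f : Fin (N + 1) → ℝ → ℝ) (D : Set ℝ)
      (t₀ M φ : ℝ), 0 ≤ t₀ → 0 ≤ M → 0 ≤ φ → D.Countable →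
      (∀ i, ContinuousOn (x i) (Icc t₀ (t₀ + L))) →
      (∀ i, i ≠ 0 → ∀ s ∈ Ioo t₀ (t₀ + L), s ∉ D →
        HasDerivAt (x i) (∑ j, a s i j * (x j s - x i s) + f i s) s) →
      (∀ i, ∀ s ∈ Ioo t₀ (t₀ + L), f i s ≤ φ) →
      (∀ s ∈ Icc t₀ (t₀ + L), x 0 s = 0) → (∀ i, x i t₀ ≤ M) →
      (∀ s ∈ Icc t₀ (t₀ + L), ∀ i, x i s ≤ M + φ * (s - t₀)) ∧
        ∀ i, x i (t₀ + L) ≤ (1 - η) * M + φ * L := by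
    intro x f D t₀ M φ ht₀ hM hφ hD hc hd hf hx0 hxM
    have hder : ∀ i, i ≠ 0 → ∀ s ∈ Ioo t₀ (t₀ + L), s ∉ D →
        HasDerivAt (fun s => M + φ * (s - t₀) - x i s)
          (φ * 1 - (∑ j, a s i j * (x j s - x i s) + f i s)) s := fun i hi s hs hsD =>
      ((((hasDerivAt_id s).sub_const t₀).const_mul φ).const_add M).sub (hd i hi s hs hsD)
    -- The slope `φ` of the moving barrier absorbs the input, and the barrier cancels in all
    -- differences.
    have hsuper : IsSupersolution a (fun i s => M + φ * (s - t₀) - x i s) D t₀ (t₀ + L) :=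
      { countable := hD
        continuousOn := fun i => ContinuousOn.sub (by fun_prop) (hc i)
        differentiableAt := fun i hi s hs hsD => (hder i hi s hs hsD).differentiableAt
        le_deriv := fun i hi s hs hsD => by
          rw [(hder i hi s hs hsD).deriv]
          have e : ∑ j, a s i j * (M + φ * (s - t₀) - x j s - (M + φ * (s - t₀) - x i s)) =
              -∑ j, a s i j * (x j s - x i s) := by
            rw [← Finset.sum_neg_distrib]
            exact Finset.sum_congr rfl fun j _ => by ring
          rw [e]
          linarith [hf i s hs] }
    obtain ⟨h1, h2⟩ := hlow _ D t₀ M ht₀ hM hsuper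
      (fun s hs => by
        have := mul_nonneg hφ (sub_nonneg.2 hs.1)
        simp only [hx0 s hs]
        linarith)
      (fun i => by simpa using hxM i)
    refine ⟨fun s hs i => by linarith [h1 s hs i], fun i => ?_⟩
    have := h2 i
    simp only [add_sub_cancel_left] at this
    linarith
  refine ⟨L, hL, η, hη, hη1, ?_⟩
  intro x f D t₀ M φ ht₀ hM hφ hD hc hd hf hx0 hxM
  obtain ⟨u1, u2⟩ := upper x f D t₀ M φ ht₀ hM hφ hD hc hd
    (fun i s hs => (abs_le.1 (hf i s hs)).2) hx0 (fun i => (abs_le.1 (hxM i)).2)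
  obtain ⟨l1, l2⟩ := upper (fun i s => -x i s) (fun i s => -f i s) D t₀ M φ ht₀ hM hφ hD
    (fun i => (hc i).neg)
    (fun i hi s hs hsD => by
      have e : ∑ j, a s i j * (-x j s - -x i s) + -f i s =
          -(∑ j, a s i j * (x j s - x i s) + f i s) := by
        rw [neg_add, ← Finset.sum_neg_distrib]
        congr 1
        exact Finset.sum_congr rfl fun j _ => by ring
      rw [e]
      exact (hd i hi s hs hsD).neg)
    (fun i s hs => by linarith [(abs_le.1 (hf i s hs)).1])
    (fun s hs => by simp [hx0 s hs]) (fun i => by linarith [(abs_le.1 (hxM i)).1])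
  exact ⟨fun s hs i => abs_le.2 ⟨by linarith [l1 s hs i], u1 s hs i⟩,
    fun i => abs_le.2 ⟨by linarith [l2 i], u2 i⟩⟩

/-- A continuous function which contracts over each time window of length `L`, up to an
exponentially decaying term, decays exponentially. -/
theorem exists_exp_decay_of_contraction {μ : ℝ → ℝ} (hμ : ContinuousOn μ (Ici 0))
    {L q γ c t₁ : ℝ} (hL : 0 < L) (hq0 : 0 ≤ q) (hq1 : q < 1) (hγ : 0 < γ) (hc : 0 ≤ c)
    (ht₁ : 0 ≤ t₁) (h : ∀ t, t₁ ≤ t → μ (t + L) ≤ q * μ t + c * Real.exp (-(γ * t))) :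
    ∃ K γ' : ℝ, 0 ≤ K ∧ 0 < γ' ∧ ∀ t, 0 ≤ t → μ t ≤ K * Real.exp (-(γ' * t)) := by
  have hlog : 0 < Real.log (2 / (1 + q)) :=
    Real.log_pos (by rw [lt_div_iff₀ (by linarith)]; linarith)
  -- Per window the claimed bound shrinks at most by `(1 + q) / 2`, the midpoint between `q` and
  -- `1`; the room `(1 - q) / 2` is spent on the forcing term through the choice of `K`.
  set γ' := min γ (Real.log (2 / (1 + q)) / L) with hγ'
  have hγ'0 : 0 < γ' := lt_min hγ (div_pos hlog hL)
  have hrate : (1 + q) / 2 ≤ Real.exp (-(γ' * L)) := by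
    have h1 : γ' * L ≤ Real.log (2 / (1 + q)) := (le_div_iff₀ hL).1 (min_le_right _ _)
    calc (1 + q) / 2 = Real.exp (-Real.log (2 / (1 + q))) := by
          rw [Real.exp_neg, Real.exp_log (by positivity), inv_div]
      _ ≤ _ := Real.exp_le_exp.2 (by linarith)
  obtain ⟨K₀, hK₀⟩ := isCompact_Icc.exists_bound_of_continuousOn
    (hμ.mono (Icc_subset_Ici_self : Icc 0 (t₁ + L) ⊆ Ici 0))
  have hK₀0 : 0 ≤ K₀ := (norm_nonneg _).trans (hK₀ 0 ⟨le_rfl, by linarith⟩)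
  set K := K₀ * Real.exp (γ' * (t₁ + L)) + 2 * c / (1 - q) with hK
  have hq : 0 < 1 - q := by linarith
  have hKc : c ≤ K * ((1 - q) / 2) := by
    have h1 : 2 * c / (1 - q) * ((1 - q) / 2) = c := by field_simp
    have h2 : 0 ≤ K₀ * Real.exp (γ' * (t₁ + L)) * ((1 - q) / 2) := by positivity
    rw [hK, add_mul, h1]
    linarith
  have hK0 : 0 ≤ K := by positivity
  have key : ∀ n : ℕ, ∀ t, 0 ≤ t → t ≤ t₁ + L + n * L → μ t ≤ K * Real.exp (-(γ' * t)) := by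
    intro n
    induction n with
    | zero =>
      intro t ht0 ht
      have ht : t ≤ t₁ + L := by simpa using ht
      calc μ t ≤ K₀ := (le_abs_self _).trans (hK₀ t ⟨ht0, ht⟩)
        _ = K₀ * Real.exp (γ' * t) * Real.exp (-(γ' * t)) := by
          rw [mul_assoc, ← Real.exp_add]; simp
        _ ≤ K * Real.exp (-(γ' * t)) := by
          refine mul_le_mul_of_nonneg_right ?_ (Real.exp_pos _).le
          have h1 : Real.exp (γ' * t) ≤ Real.exp (γ' * (t₁ + L)) :=
            Real.exp_le_exp.2 (mul_le_mul_of_nonneg_left ht hγ'0.le)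
          have h2 : 0 ≤ 2 * c / (1 - q) := by positivity
          linarith [mul_le_mul_of_nonneg_left h1 hK₀0]
    | succ n ih =>
      intro t ht0 ht
      by_cases htn : t ≤ t₁ + L + n * L
      · exact ih t ht0 htn
      have hn : 0 ≤ (n : ℝ) * L := by positivity
      push_cast at ht
      have h1 : t₁ ≤ t - L := by linarith
      have h2 := ih (t - L) (by linarith) (by linarith)
      have h3 := h (t - L) h1
      rw [sub_add_cancel] at h3
      have h4 : Real.exp (-(γ * (t - L))) ≤ Real.exp (-(γ' * (t - L))) :=
        Real.exp_le_exp.2 (neg_le_neg (mul_le_mul_of_nonneg_right (min_le_left _ _)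
          (by linarith)))
      have h5 : Real.exp (-(γ' * t)) = Real.exp (-(γ' * L)) * Real.exp (-(γ' * (t - L))) := by
        rw [← Real.exp_add]; congr 1; ring
      have h6 : q * K + c ≤ K * Real.exp (-(γ' * L)) := by
        linarith [mul_le_mul_of_nonneg_left hrate hK0]
      calc μ t ≤ q * (K * Real.exp (-(γ' * (t - L)))) + c * Real.exp (-(γ' * (t - L))) :=
            h3.trans (add_le_add (mul_le_mul_of_nonneg_left h2 hq0)
              (mul_le_mul_of_nonneg_left h4 hc))
        _ = (q * K + c) * Real.exp (-(γ' * (t - L))) := by ring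
        _ ≤ K * Real.exp (-(γ' * L)) * Real.exp (-(γ' * (t - L))) :=
            mul_le_mul_of_nonneg_right h6 (Real.exp_pos _).le
        _ = K * Real.exp (-(γ' * t)) := by rw [h5]; ring
  refine ⟨K, γ', hK0, hγ'0, fun t ht => ?_⟩
  obtain ⟨n, hn⟩ := exists_nat_ge (t / L)
  exact key n t ht (by linarith [(div_le_iff₀ hL).1 hn])

/-- The leader-following consensus protocol, with an exponentially vanishing perturbation which
grows at most linearly with the state, converges exponentially. -/
theorem exists_exp_decay_of_perturbed_consensus (hnet : IsCommunicationNetwork G a)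
    (hdwell : HasDwellTime G) (htree : UniformlyContainsSpanningTree G 0)
    {ι : Type*} [Fintype ι] {Y f : ℝ → Fin (N + 1) → ι → ℝ} {D : Set ℝ} (hD : D.Countable)
    (hY : ContinuousOn Y (Ici 0)) (hY0 : ∀ t, 0 ≤ t → Y t 0 = 0)
    (hd : ∀ i, i ≠ 0 → ∀ p, ∀ t, 0 < t → t ∉ D →
      HasDerivAt (fun s => Y s i p) (∑ j, a t i j * (Y t j p - Y t i p) + f t i p) t)
    {K γ c : ℝ} (hK : 0 ≤ K) (hγ : 0 < γ) (hc : 0 ≤ c)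
    (hf : ∀ t, 0 < t → ‖f t‖ ≤ K * Real.exp (-(γ * t)) * (‖Y t‖ + c)) :
    ∃ K' γ' : ℝ, 0 ≤ K' ∧ 0 < γ' ∧ ∀ t, 0 ≤ t → ‖Y t‖ ≤ K' * Real.exp (-(γ' * t)) := by
  obtain ⟨L, hL, η, hη, hη1, hcon⟩ := exists_contraction hnet hdwell htree
  have hlim : Tendsto (fun t : ℝ => K * Real.exp (-(γ * t)) * L) atTop (𝓝 0) := by
    have h1 : Tendsto (fun t : ℝ => Real.exp (-(γ * t))) atTop (𝓝 0) :=
      Real.tendsto_exp_neg_atTop_nhds_zero.comp (tendsto_id.const_mul_atTop hγ)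
    simpa using (h1.const_mul K).mul_const L
  obtain ⟨t₁, ht₁⟩ := eventually_atTop.1
    ((hlim.eventually_le_const (show (0 : ℝ) < η / 4 by positivity)).and (eventually_ge_atTop 0))
  -- After `t₁` the perturbation costs at most `2 d L (‖Y t‖ + c)` per window, with `d L ≤ η / 4`;
  -- half of the contraction survives.
  refine exists_exp_decay_of_contraction hY.norm (q := 1 - η / 2) (c := 2 * K * L * c)
    (t₁ := t₁) hL (by linarith) (by linarith) hγ (by positivity) (ht₁ t₁ le_rfl).2 fun t ht => ?_
  obtain ⟨hsmall, ht0⟩ := ht₁ t ht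
  have hsub : Icc t (t + L) ⊆ Ici 0 := fun s hs => ht0.trans hs.1
  obtain ⟨s₀, hs₀, hmax⟩ := isCompact_Icc.exists_isMaxOn (nonempty_Icc.2 (by linarith))
    (hY.norm.mono hsub)
  set d := K * Real.exp (-(γ * t)) with hd_def
  have hd0 : 0 ≤ d := by positivity
  -- A uniform bound for the perturbation on the window: `‖Y‖` is largest at `s₀` and the
  -- exponential at `t`.
  set φ := d * (‖Y s₀‖ + c) with hφ
  have hφ0 : 0 ≤ φ := by positivity
  have happ := fun p => hcon (fun i s => Y s i p) (fun i s => f s i p) D t ‖Y t‖ φ ht0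
    (norm_nonneg _) hφ0 hD
    (fun i => (continuousOn_pi.1 (continuousOn_pi.1 (hY.mono hsub) i) p))
    (fun i hi s hs hsD => hd i hi p s (ht0.trans_lt hs.1) hsD)
    (fun i s hs => by
      have h1 : ‖f s i p‖ ≤ ‖f s‖ := (norm_le_pi_norm (f s i) p).trans (norm_le_pi_norm (f s) i)
      refine h1.trans ((hf s (ht0.trans_lt hs.1)).trans ?_)
      have h2 : ‖Y s‖ ≤ ‖Y s₀‖ := hmax (Ioo_subset_Icc_self hs)
      have h3 : Real.exp (-(γ * s)) ≤ Real.exp (-(γ * t)) :=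
        Real.exp_le_exp.2 (neg_le_neg (mul_le_mul_of_nonneg_left hs.1.le hγ.le))
      exact mul_le_mul (mul_le_mul_of_nonneg_left h3 hK) (by linarith) (by positivity) hd0)
    (fun s hs => by simp [hY0 s (hsub hs)])
    (fun i => (norm_le_pi_norm (Y t i) p).trans (norm_le_pi_norm (Y t) i))
  have hZ : ‖Y s₀‖ ≤ ‖Y t‖ + φ * L := by
    refine (pi_norm_le_iff_of_nonneg (by positivity)).2 fun i =>
      (pi_norm_le_iff_of_nonneg (by positivity)).2 fun p => ((happ p).1 s₀ hs₀ i).trans ?_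
    have := mul_le_mul_of_nonneg_left (show s₀ - t ≤ L by linarith [hs₀.2]) hφ0
    linarith
  have hend : ‖Y (t + L)‖ ≤ (1 - η) * ‖Y t‖ + φ * L := by
    have h0 : 0 ≤ (1 - η) * ‖Y t‖ + φ * L :=
      add_nonneg (mul_nonneg (by linarith) (norm_nonneg _)) (by positivity)
    exact (pi_norm_le_iff_of_nonneg h0).2 fun i =>
      (pi_norm_le_iff_of_nonneg h0).2 fun p => (happ p).2 i
  have hdL0 : 0 ≤ d * L := by positivity
  have hφL : φ * L = d * L * (‖Y s₀‖ + c) := by rw [hφ]; ring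
  -- As `d L ≤ 1 / 2`, the maximum on the right of `hZ` is absorbed into the left.
  have hZ2 : ‖Y s₀‖ ≤ 2 * ‖Y t‖ + c := by
    have : d * L * (‖Y s₀‖ + c) ≤ 1 / 2 * (‖Y s₀‖ + c) :=
      mul_le_mul_of_nonneg_right (by linarith) (by positivity)
    linarith
  have h1 : d * L * (‖Y s₀‖ + c) ≤ d * L * (2 * ‖Y t‖ + 2 * c) :=
    mul_le_mul_of_nonneg_left (by linarith) hdL0
  have h2 : d * L * ‖Y t‖ ≤ η / 4 * ‖Y t‖ := mul_le_mul_of_nonneg_right hsmall (norm_nonneg _)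
  have h3 : 2 * K * L * c * Real.exp (-(γ * t)) = 2 * (d * L) * c := by rw [hd_def]; ring
  rw [h3]
  linarith

end Contraction

/-! ### Subexponential growth of the matrix exponential -/

section MatrixExponential
open scoped Matrix.Norms.Operator

/-- Every eigenvalue of `exp B` is the exponential of an eigenvalue of `B`. -/
theorem exists_mem_spectrum_exp_eq {r : ℕ} (B : Matrix (Fin r) (Fin r) ℂ) {z : ℂ}
    (hz : z ∈ spectrum ℂ (NormedSpace.exp B)) : ∃ μ ∈ spectrum ℂ B, Complex.exp μ = z := by
  set E := NormedSpace.exp B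
  have hcomm : Commute B E := (Commute.refl B).exp_right
  rw [← Matrix.spectrum_toLin', ← Module.End.hasEigenvalue_iff_mem_spectrum] at hz
  set W := Module.End.eigenspace (Matrix.toLin' E) z
  have hinv : ∀ v ∈ W, Matrix.toLin' B v ∈ W := by
    intro v hv
    rw [Module.End.mem_eigenspace_iff] at hv ⊢
    simp only [Matrix.toLin'_apply] at hv ⊢
    rw [Matrix.mulVec_mulVec, ← hcomm.eq, ← Matrix.mulVec_mulVec, hv, Matrix.mulVec_smul]
  have : Nontrivial W := Submodule.nontrivial_iff_ne_bot.2 hz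
  -- `B` commutes with `E`, hence preserves its eigenspace `W` and has an eigenvector there, on
  -- which the exponential series sums to `exp μ`.
  obtain ⟨μ, hμ⟩ := Module.End.exists_eigenvalue ((Matrix.toLin' B).restrict hinv)
  obtain ⟨v, hv⟩ := hμ.exists_hasEigenvector
  have hv0 : (v : Fin r → ℂ) ≠ 0 := by simpa using hv.2
  have hBv : B.mulVec v = μ • (v : Fin r → ℂ) := by
    have := congrArg Subtype.val hv.apply_eq_smul
    simpa using this
  have hEv : E.mulVec v = z • (v : Fin r → ℂ) := by
    have := Module.End.mem_eigenspace_iff.1 v.2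
    simpa using this
  refine ⟨μ, ?_, ?_⟩
  · rw [← Matrix.spectrum_toLin', ← Module.End.hasEigenvalue_iff_mem_spectrum]
    exact Module.End.hasEigenvalue_of_hasEigenvector (x := (v : Fin r → ℂ))
      ⟨Module.End.mem_eigenspace_iff.2 (by simpa using hBv), hv0⟩
  · have hexp : E.mulVec v = Complex.exp μ • (v : Fin r → ℂ) := by
      have hpow : ∀ n : ℕ, (B ^ n).mulVec v = μ ^ n • (v : Fin r → ℂ) := by
        intro n
        induction n with
        | zero => simp
        | succ n ih => rw [pow_succ, ← Matrix.mulVec_mulVec, hBv, Matrix.mulVec_smul, ih, smul_smul,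
            pow_succ, mul_comm]
      have h1 : HasSum (fun n : ℕ => ((n.factorial : ℂ)⁻¹ • B ^ n).mulVec v) (E.mulVec v) :=
        (NormedSpace.exp_series_hasSum_exp' (𝕂 := ℂ) B).map
          (⟨⟨fun M : Matrix (Fin r) (Fin r) ℂ => M.mulVec v, by simp⟩,
            fun M M' => Matrix.add_mulVec M M' v⟩ : Matrix (Fin r) (Fin r) ℂ →+ _)
          (Continuous.matrix_mulVec continuous_id continuous_const)
      have h2 := (NormedSpace.exp_series_hasSum_exp' (𝕂 := ℂ) μ).smul_const (v : Fin r → ℂ)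
      rw [← Complex.exp_eq_exp_ℂ] at h2
      refine h1.unique ?_
      convert h2 using 2 with n
      rw [Matrix.smul_mulVec, hpow, smul_smul, smul_eq_mul]
    have hsub : (Complex.exp μ - z) • (v : Fin r → ℂ) = 0 := by rw [sub_smul, ← hexp, hEv, sub_self]
    exact sub_eq_zero.1 ((smul_eq_zero.1 hsub).resolve_right hv0)

/-- The spectral radius of `exp B` is at most `1 < exp ε`, so Gelfand's formula bounds all large
powers; finitely many powers and the fractional part of `t` cost only constants. -/
theorem exists_norm_exp_smul_le_of_re_nonpos {r : ℕ} {B : Matrix (Fin r) (Fin r) ℂ}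
    (hB : ∀ μ ∈ spectrum ℂ B, μ.re ≤ 0) {ε : ℝ} (hε : 0 < ε) :
    ∃ C : ℝ, ∀ t : ℝ, 0 ≤ t → ‖NormedSpace.exp (t • B)‖ ≤ C * Real.exp (ε * t) := by
  set E := NormedSpace.exp B with hE
  have hrad : spectralRadius ℂ E < ((Real.exp ε).toNNReal : ENNReal) := by
    refine lt_of_le_of_lt (b := ((1 : NNReal) : ENNReal)) (iSup₂_le fun z hz => ?_) ?_
    · obtain ⟨μ, hμ, rfl⟩ := exists_mem_spectrum_exp_eq B hz
      refine ENNReal.coe_le_coe.2 ?_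
      rw [← NNReal.coe_le_coe]
      simpa [Complex.norm_exp] using hB μ hμ
    · refine ENNReal.coe_lt_coe.2 ?_
      rw [← NNReal.coe_lt_coe, Real.coe_toNNReal _ (Real.exp_pos _).le]
      simpa using hε
  have hlim := spectrum.pow_nnnorm_pow_one_div_tendsto_nhds_spectralRadius E
  obtain ⟨n₀, hn₀⟩ := eventually_atTop.1 ((hlim.eventually_lt_const hrad).and
    (eventually_gt_atTop 0))
  have hpow : ∀ n, n₀ ≤ n → ‖E ^ n‖ ≤ Real.exp (ε * n) := by
    intro n hn
    obtain ⟨h1, h2⟩ := hn₀ n hn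
    have h3 := ENNReal.rpow_le_rpow h1.le (Nat.cast_nonneg n : (0 : ℝ) ≤ n)
    rw [← ENNReal.rpow_mul, one_div, inv_mul_cancel₀ (by positivity), ENNReal.rpow_one,
      ENNReal.rpow_natCast, ← ENNReal.coe_pow, ENNReal.coe_le_coe, ← NNReal.coe_le_coe] at h3
    rw [NNReal.coe_pow, Real.coe_toNNReal _ (Real.exp_pos _).le,
      ← Real.exp_nat_mul, mul_comm] at h3
    simpa using h3
  obtain ⟨C₀, hC₀, hC₀n⟩ : ∃ C₀ : ℝ, 1 ≤ C₀ ∧ ∀ n, n ≤ n₀ → ‖E ^ n‖ ≤ C₀ :=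
    ⟨1 + ∑ n ∈ Finset.range (n₀ + 1), ‖E ^ n‖, by
      have : 0 ≤ ∑ n ∈ Finset.range (n₀ + 1), ‖E ^ n‖ := Finset.sum_nonneg fun _ _ => norm_nonneg _
      linarith, fun n hn => by
      have := Finset.single_le_sum (f := fun n => ‖E ^ n‖) (fun _ _ => norm_nonneg _)
        (Finset.mem_range.2 (Nat.lt_succ_of_le hn))
      linarith⟩
  have hall : ∀ n : ℕ, ‖E ^ n‖ ≤ C₀ * Real.exp (ε * n) := by
    intro n
    have h1 : 1 ≤ Real.exp (ε * n) := Real.one_le_exp (by positivity)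
    rcases le_total n n₀ with h | h
    · nlinarith [hC₀n n h]
    · nlinarith [hpow n h]
  have hcont : Continuous fun t : ℝ => NormedSpace.exp (t • B) :=
    NormedSpace.exp_continuous.comp (continuous_id.smul continuous_const)
  obtain ⟨C₁, hC₁⟩ := isCompact_Icc.exists_bound_of_continuousOn
    (hcont.continuousOn : ContinuousOn _ (Icc (0 : ℝ) 1))
  refine ⟨C₀ * C₁, fun t ht => ?_⟩
  have hsplit : NormedSpace.exp (t • B) =
      E ^ ⌊t⌋₊ * NormedSpace.exp ((t - ⌊t⌋₊) • B) := by
    rw [hE, ← Matrix.exp_nsmul, ← Matrix.exp_add_of_commute]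
    · congr 1
      rw [← Nat.cast_smul_eq_nsmul ℝ, ← add_smul]
      congr 1; ring
    · exact ((Commute.refl B).smul_right _).smul_left _
  rw [hsplit]
  have hfl := Nat.floor_le ht
  have h1 := hC₁ (t - ⌊t⌋₊) ⟨by linarith, by linarith [Nat.lt_floor_add_one t]⟩
  have h2 : Real.exp (ε * ⌊t⌋₊) ≤ Real.exp (ε * t) :=
    Real.exp_le_exp.2 (mul_le_mul_of_nonneg_left hfl hε.le)
  have h3 : 0 ≤ C₁ := (norm_nonneg _).trans h1
  calc _ ≤ ‖E ^ ⌊t⌋₊‖ * ‖NormedSpace.exp ((t - ⌊t⌋₊) • B)‖ := norm_mul_le _ _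
    _ ≤ (C₀ * Real.exp (ε * ⌊t⌋₊)) * C₁ := mul_le_mul (hall _) h1 (norm_nonneg _) (by positivity)
    _ ≤ (C₀ * Real.exp (ε * t)) * C₁ := by gcongr
    _ = _ := by ring

/-- If the spectrum of a real matrix lies on the imaginary axis, then its exponential grows
subexponentially in both time directions. -/
theorem exists_norm_exp_smul_le {r : ℕ} {A : Matrix (Fin r) (Fin r) ℝ}
    (hA : ∀ μ ∈ spectrum ℂ (A.map (algebraMap ℝ ℂ)), μ.re = 0) {ε : ℝ} (hε : 0 < ε) :
    ∃ C : ℝ, 0 ≤ C ∧ ∀ t : ℝ, ‖NormedSpace.exp (t • A)‖ ≤ C * Real.exp (ε * |t|) := by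
  set B := A.map (algebraMap ℝ ℂ) with hB
  obtain ⟨C₁, h₁⟩ := exists_norm_exp_smul_le_of_re_nonpos (fun μ hμ => (hA μ hμ).le) hε
  obtain ⟨C₂, h₂⟩ := exists_norm_exp_smul_le_of_re_nonpos (B := -B) (fun μ hμ => by
    have := hA (-μ) (by rwa [← Set.mem_neg, spectrum.neg_eq]) 
    simp at this; linarith) hε
  -- The operator norm for the sup norm depends only on absolute values of entries, so
  -- complexification preserves it.
  have hnorm : ∀ t : ℝ, ‖NormedSpace.exp (t • A)‖ = ‖NormedSpace.exp (t • B)‖ := by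
    intro t
    have hmap : (NormedSpace.exp (t • A)).map (algebraMap ℝ ℂ) = NormedSpace.exp (t • B) := by
      have := NormedSpace.map_exp ((algebraMap ℝ ℂ).mapMatrix (m := Fin r))
        (Continuous.matrix_map continuous_id Complex.continuous_ofReal) (t • A)
      rw [RingHom.mapMatrix_apply] at this
      refine this.trans (congrArg NormedSpace.exp ?_)
      ext i j
      simp [hB]
    rw [← hmap, Matrix.linfty_opNorm_def, Matrix.linfty_opNorm_def]
    simp
  have hexp : ∀ t : ℝ, 0 < Real.exp (ε * |t|) := fun t => Real.exp_pos _
  refine ⟨max (max C₁ C₂) 0, le_max_right _ _, fun t => ?_⟩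
  rw [hnorm]
  rcases le_total 0 t with ht | ht
  · refine (h₁ t ht).trans ?_
    rw [abs_of_nonneg ht]
    exact mul_le_mul_of_nonneg_right ((le_max_left _ _).trans (le_max_left _ _))
      (Real.exp_pos _).le
  · have := h₂ (-t) (by linarith)
    rw [smul_neg, neg_smul, neg_neg] at this
    refine this.trans ?_
    rw [abs_of_nonpos ht]
    exact mul_le_mul_of_nonneg_right ((le_max_right _ _).trans (le_max_left _ _))
      (Real.exp_pos _).le

end MatrixExponential

/-! ### Convergence of the exosystem generator -/

section Trajectory
open scoped Matrix.Norms.Operator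

variable {N r : ℕ} {G : ℝ → Digraph (Fin (N + 1))} {a : ℝ → Fin (N + 1) → Fin (N + 1) → ℝ}
  {S₀ : Matrix (Fin r) (Fin r) ℝ} {S : Fin (N + 1) → ℝ → Matrix (Fin r) (Fin r) ℝ}
  {w : Fin (N + 1) → ℝ → Fin r → ℝ}

theorem exists_common_exceptional_set {ι : Type*} [Countable ι] {x v : ι → ℝ → ℝ}
    (h : ∀ i, SolvesODE (x i) (v i)) :
    ∃ D : Set ℝ, D.Countable ∧ ∀ i t, 0 < t → t ∉ D → HasDerivAt (x i) (v i t) t := by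
  choose D hD hd using fun i => (h i).2
  exact ⟨⋃ i, D i, countable_iUnion hD, fun i t ht htD =>
    hd i t ht fun hmem => htD (mem_iUnion.2 ⟨i, hmem⟩)⟩

theorem norm_le_card_mul_of_entry_le {A : Matrix (Fin r) (Fin r) ℝ} {c : ℝ} (hc : 0 ≤ c)
    (h : ∀ p q, |A p q| ≤ c) : ‖A‖ ≤ r * c := by
  lift c to NNReal using hc
  rw [Matrix.linfty_opNorm_def]
  have : (Finset.univ.sup fun i => ∑ j, ‖A i j‖₊) ≤ (r : NNReal) * c := Finset.sup_le fun i _ => by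
    calc ∑ j, ‖A i j‖₊ ≤ ∑ _j : Fin r, c := Finset.sum_le_sum fun j _ => by
          rw [← NNReal.coe_le_coe]; simpa using h i j
      _ = _ := by simp
  exact_mod_cast this

/-- Subtracting the constant `S₀` leaves differences unchanged, so the entries of the error follow
the protocol with zero perturbation. -/
theorem IsExosystemGeneratorTrajectory.exists_norm_S_sub_le
    (hsol : IsExosystemGeneratorTrajectory a S₀ S w) (hnet : IsCommunicationNetwork G a)
    (hdwell : HasDwellTime G) (htree : UniformlyContainsSpanningTree G 0) :
    ∃ K γ : ℝ, 0 ≤ K ∧ 0 < γ ∧ ∀ t, 0 ≤ t → ∀ i, ‖S i t - S₀‖ ≤ K * Real.exp (-(γ * t)) := by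
  obtain ⟨D, hD, hder⟩ := exists_common_exceptional_set
    (ι := {i : Fin (N + 1) // i ≠ 0} × Fin r × Fin r)
    fun k => hsol.agent_S k.1 k.1.2 k.2.1 k.2.2
  obtain ⟨K, γ, hK, hγ, h⟩ := exists_exp_decay_of_perturbed_consensus hnet hdwell htree
    (Y := fun t i (k : Fin r × Fin r) => S i t k.1 k.2 - S₀ k.1 k.2) (f := fun _ => 0) hD
    (continuousOn_pi.2 fun i => continuousOn_pi.2 fun k => by
      refine ContinuousOn.sub ?_ continuousOn_const
      by_cases hi : i = 0
      · subst hi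
        exact (continuousOn_const (c := S₀ k.1 k.2)).congr fun t ht => by
          rw [hsol.exosystem_S t ht]
      · exact (hsol.agent_S i hi k.1 k.2).1)
    (fun t ht => by ext k; simp [hsol.exosystem_S t ht])
    (fun i hi k t ht htD => by
      have := (hder (⟨i, hi⟩, k) t ht htD).sub_const (S₀ k.1 k.2)
      simpa [Matrix.sum_apply] using this)
    (K := 0) (γ := 1) (c := 0) le_rfl one_pos le_rfl (fun t _ => by simp)
  refine ⟨r * K, γ, by positivity, hγ, fun t ht i => ?_⟩
  rw [mul_assoc]
  refine norm_le_card_mul_of_entry_le (by positivity) fun p q => le_trans ?_ (h t ht)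
  exact (norm_le_pi_norm (fun k : Fin r × Fin r => S i t k.1 k.2 - S₀ k.1 k.2) (p, q)).trans
    (norm_le_pi_norm (fun i (k : Fin r × Fin r) => S i t k.1 k.2 - S₀ k.1 k.2) i)

/-- Product rule, entry by entry; in the moving frame the drift `A x` drops out. -/
theorem hasDerivAt_exp_smul_neg_mulVec (A : Matrix (Fin r) (Fin r) ℝ) {x : ℝ → Fin r → ℝ}
    {x' : Fin r → ℝ} {t : ℝ} (hx : HasDerivAt x x' t) :
    HasDerivAt (fun s => (NormedSpace.exp (s • -A)).mulVec (x s))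
      ((NormedSpace.exp (t • -A)).mulVec (x' - A.mulVec (x t))) t := by
  refine hasDerivAt_pi.2 fun p => ?_
  have hE : ∀ q, HasDerivAt (fun s => NormedSpace.exp (s • -A) p q)
      ((NormedSpace.exp (t • -A) * -A) p q) t := fun q =>
    (Matrix.entryLinearMap ℝ ℝ p q).toContinuousLinearMap.hasFDerivAt.comp_hasDerivAt t
      (hasDerivAt_exp_smul_const (-A) t)
  have hsum := HasDerivAt.fun_sum (u := Finset.univ) fun q _ =>
    (hE q).mul (hasDerivAt_pi.1 hx q)
  have e : (NormedSpace.exp (t • -A)).mulVec (x' - A.mulVec (x t)) p =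
      ∑ q, ((NormedSpace.exp (t • -A) * -A) p q * x t q + NormedSpace.exp (t • -A) p q * x' q) := by
    rw [Finset.sum_add_distrib, Matrix.mulVec_sub, Matrix.mulVec_mulVec, Matrix.mul_neg]
    simp only [Pi.sub_apply, Matrix.mulVec, dotProduct, Matrix.neg_apply, neg_mul,
      Finset.sum_neg_distrib]
    ring
  rw [e]
  exact hsum

theorem continuousOn_exp_smul_neg_mulVec (A : Matrix (Fin r) (Fin r) ℝ) {x : ℝ → Fin r → ℝ}
    {s : Set ℝ} (hx : ContinuousOn x s) :
    ContinuousOn (fun t => (NormedSpace.exp (t • -A)).mulVec (x t)) s := by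
  have hE : Continuous fun t : ℝ => NormedSpace.exp (t • -A) :=
    NormedSpace.exp_continuous.comp (continuous_id.smul continuous_const)
  exact (Continuous.matrix_mulVec continuous_fst continuous_snd).comp_continuousOn
    (hE.continuousOn.prodMk hx)

theorem exp_smul_mul_exp_smul_neg (A : Matrix (Fin r) (Fin r) ℝ) (t : ℝ) :
    NormedSpace.exp (t • A) * NormedSpace.exp (t • -A) = 1 := by
  rw [← Matrix.exp_add_of_commute, smul_neg, add_neg_cancel, NormedSpace.exp_zero]
  exact ((Commute.refl A).neg_right.smul_right t).smul_left t

theorem IsExosystemGeneratorTrajectory.continuousOn_w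
    (hsol : IsExosystemGeneratorTrajectory a S₀ S w) (i : Fin (N + 1)) :
    ContinuousOn (w i) (Ici 0) := by
  by_cases hi : i = 0
  · subst hi
    exact fun t ht => (hsol.exosystem_w t ht).continuousWithinAt
  · exact continuousOn_pi.2 fun p => (hsol.agent_w i hi p).1

/-- In the frame moving with the exosystem, the exosystem is at rest. -/
theorem IsExosystemGeneratorTrajectory.exp_smul_neg_mulVec_exosystem
    (hsol : IsExosystemGeneratorTrajectory a S₀ S w) {t : ℝ} (ht : 0 ≤ t) :
    (NormedSpace.exp (t • -S₀)).mulVec (w 0 t) = w 0 0 := by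
  have hc : ContinuousOn (fun t : ℝ => (NormedSpace.exp (t • -S₀)).mulVec (w 0 t)) (Icc 0 t) :=
    (continuousOn_exp_smul_neg_mulVec S₀ (hsol.continuousOn_w 0)).mono Icc_subset_Ici_self
  have hd : ∀ s, 0 < s →
      HasDerivAt (fun t : ℝ => (NormedSpace.exp (t • -S₀)).mulVec (w 0 t)) 0 s := fun s hs => by
    simpa using hasDerivAt_exp_smul_neg_mulVec S₀
      ((hsol.exosystem_w s hs.le).hasDerivAt (Ici_mem_nhds hs))
  ext p
  have hcp := continuousOn_pi.1 hc p
  have hdp := fun s (hs : s ∈ Ioo 0 t) (_ : s ∉ (∅ : Set ℝ)) => hasDerivAt_pi.1 (hd s hs.1) p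
  have h1 := le_of_hasDerivAt_nonneg_off_countable ht countable_empty hcp hdp
    (fun _ _ _ => le_rfl)
  have h2 := le_of_hasDerivAt_nonneg_off_countable ht countable_empty hcp.neg
    (fun s hs h => (hdp s hs h).neg) (fun _ _ _ => by simp)
  simp only [Pi.neg_apply, zero_smul, NormedSpace.exp_zero, Matrix.one_mulVec] at h1 h2
  linarith

theorem IsExosystemGeneratorTrajectory.tendsto_w_sub
    (hsol : IsExosystemGeneratorTrajectory a S₀ S w) (hnet : IsCommunicationNetwork G a)
    (hdwell : HasDwellTime G) (htree : UniformlyContainsSpanningTree G 0)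
    (hS₀ : ∀ μ ∈ spectrum ℂ (S₀.map (algebraMap ℝ ℂ)), μ.re = 0) (i : Fin (N + 1)) :
    Tendsto (fun t => w i t - w 0 t) atTop (𝓝 0) := by
  obtain ⟨K, γ, hK, hγ, hS⟩ := hsol.exists_norm_S_sub_le hnet hdwell htree
  -- Conjugation uses two exponentials at rate `γ / 4`, leaving decay `γ / 2` for the perturbation.
  obtain ⟨C, hC, hexp⟩ := exists_norm_exp_smul_le hS₀ (show 0 < γ / 4 by positivity)
  obtain ⟨D, hD, hder⟩ := exists_common_exceptional_set
    (ι := {i : Fin (N + 1) // i ≠ 0} × Fin r) fun k => hsol.agent_w k.1 k.1.2 k.2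
  set z : Fin (N + 1) → ℝ → Fin r → ℝ := fun i t => (NormedSpace.exp (t • -S₀)).mulVec (w i t)
    with hz
  have hz0 : ∀ t, 0 ≤ t → z 0 t = w 0 0 := fun t ht => hsol.exp_smul_neg_mulVec_exosystem ht
  have hwz : ∀ i t, w i t = (NormedSpace.exp (t • S₀)).mulVec (z i t) := fun i t => by
    simp only [hz, Matrix.mulVec_mulVec, exp_smul_mul_exp_smul_neg, Matrix.one_mulVec]
  have hzc : ∀ i, ContinuousOn (z i) (Ici 0) := fun i =>
    continuousOn_exp_smul_neg_mulVec S₀ (hsol.continuousOn_w i)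
  obtain ⟨K', γ', hK', hγ', hY⟩ := exists_exp_decay_of_perturbed_consensus hnet hdwell htree
    (Y := fun t i => z i t - w 0 0)
    (f := fun t i => (NormedSpace.exp (t • -S₀) * (S i t - S₀) * NormedSpace.exp (t • S₀)).mulVec
      (z i t)) hD
    (continuousOn_pi.2 fun i => (hzc i).sub continuousOn_const)
    (fun t ht => by simp [hz0 t ht])
    (fun i hi p t ht htD => by
      have hw : HasDerivAt (w i) ((S i t).mulVec (w i t) + ∑ j, a t i j • (w j t - w i t)) t :=
        hasDerivAt_pi.2 fun p => hder (⟨i, hi⟩, p) t ht htD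
      have h1 := (hasDerivAt_pi.1 (hasDerivAt_exp_smul_neg_mulVec S₀ hw) p).sub_const (w 0 0 p)
      have e : (NormedSpace.exp (t • -S₀)).mulVec
          ((S i t).mulVec (w i t) + ∑ j, a t i j • (w j t - w i t) - S₀.mulVec (w i t)) =
          ∑ j, a t i j • (z j t - z i t) + (NormedSpace.exp (t • -S₀) * (S i t - S₀) *
            NormedSpace.exp (t • S₀)).mulVec (z i t) := by
        rw [← Matrix.mulVec_mulVec, ← hwz, ← Matrix.mulVec_mulVec, Matrix.sub_mulVec,
          add_sub_right_comm, Matrix.mulVec_add, add_comm]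
        congr 1
        simp only [hz, ← Matrix.mulVec_sub, ← Matrix.mulVec_smul, ← Matrix.mulVec_sum]
      rw [e] at h1
      simpa [hz] using h1)
    -- The perturbation acts on `z i`, not on the error `z i - w 0 0`; hence the offset `c`.
    (K := C * C * K) (γ := γ / 2) (c := ‖w 0 0‖) (by positivity) (by positivity) (norm_nonneg _)
    (fun t ht => by
      refine (pi_norm_le_iff_of_nonneg (by positivity)).2 fun i => ?_
      have h1 : ‖NormedSpace.exp (t • -S₀)‖ ≤ C * Real.exp (γ / 4 * t) := by
        have := hexp (-t)
        rwa [abs_neg, abs_of_pos ht, neg_smul, ← smul_neg] at this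
      have h2 : ‖NormedSpace.exp (t • S₀)‖ ≤ C * Real.exp (γ / 4 * t) := by
        have := hexp t
        rwa [abs_of_pos ht] at this
      have h3 : ‖z i t‖ ≤ ‖fun i => z i t - w 0 0‖ + ‖w 0 0‖ := by
        have h4 := norm_le_pi_norm (fun i => z i t - w 0 0) i
        have h5 := norm_add_le (z i t - w 0 0) (w 0 0)
        rw [sub_add_cancel] at h5
        linarith
      have h6 : Real.exp (γ / 4 * t) * Real.exp (-(γ * t)) * Real.exp (γ / 4 * t) =
          Real.exp (-(γ / 2 * t)) := by
        rw [← Real.exp_add, ← Real.exp_add]; congr 1; ring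
      calc _ ≤ ‖NormedSpace.exp (t • -S₀)‖ * ‖S i t - S₀‖ * ‖NormedSpace.exp (t • S₀)‖ * ‖z i t‖ :=
            (Matrix.linfty_opNorm_mulVec _ _).trans (mul_le_mul_of_nonneg_right
              ((norm_mul_le _ _).trans (mul_le_mul_of_nonneg_right (norm_mul_le _ _)
                (norm_nonneg _))) (norm_nonneg _))
        _ ≤ (C * Real.exp (γ / 4 * t)) * (K * Real.exp (-(γ * t))) * (C * Real.exp (γ / 4 * t)) *
            (‖fun i => z i t - w 0 0‖ + ‖w 0 0‖) := by
          gcongr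
          exact hS t ht.le i
        _ = _ := by rw [← h6]; ring)
  -- Returning to the original frame may use up only half of the decay rate `γ'`.
  obtain ⟨C', hC', hexp'⟩ := exists_norm_exp_smul_le hS₀ (show 0 < γ' / 2 by positivity)
  have hlim : Tendsto (fun t : ℝ => C' * K' * Real.exp (-(γ' / 2 * t))) atTop (𝓝 0) := by
    have h1 : Tendsto (fun t : ℝ => Real.exp (-(γ' / 2 * t))) atTop (𝓝 0) :=
      Real.tendsto_exp_neg_atTop_nhds_zero.comp
        (tendsto_id.const_mul_atTop (show 0 < γ' / 2 by positivity))
    simpa using h1.const_mul (C' * K')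
  refine squeeze_zero_norm' (eventually_atTop.2 ⟨0, fun t ht => ?_⟩) hlim
  have e : w i t - w 0 t = (NormedSpace.exp (t • S₀)).mulVec (z i t - w 0 0) := by
    rw [← hz0 t ht, Matrix.mulVec_sub, ← hwz, ← hwz]
  have h1 := hexp' t
  rw [abs_of_nonneg ht] at h1
  have h2 : ‖z i t - w 0 0‖ ≤ K' * Real.exp (-(γ' * t)) :=
    (norm_le_pi_norm (fun i => z i t - w 0 0) i).trans (hY t ht)
  rw [e]
  calc _ ≤ ‖NormedSpace.exp (t • S₀)‖ * ‖z i t - w 0 0‖ := Matrix.linfty_opNorm_mulVec _ _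
    _ ≤ (C' * Real.exp (γ' / 2 * t)) * (K' * Real.exp (-(γ' * t))) :=
        mul_le_mul h1 h2 (norm_nonneg _) (by positivity)
    _ = C' * K' * (Real.exp (γ' / 2 * t) * Real.exp (-(γ' * t))) := by ring
    _ = _ := by rw [← Real.exp_add]; congr 2; ring

theorem IsExosystemGeneratorTrajectory.tendsto_S_sub
    (hsol : IsExosystemGeneratorTrajectory a S₀ S w) (hnet : IsCommunicationNetwork G a)
    (hdwell : HasDwellTime G) (htree : UniformlyContainsSpanningTree G 0) (i : Fin (N + 1)) :
    Tendsto (fun t => S i t - S₀) atTop (𝓝 0) := by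
  obtain ⟨K, γ, hK, hγ, hS⟩ := hsol.exists_norm_S_sub_le hnet hdwell htree
  have h1 : Tendsto (fun t : ℝ => Real.exp (-(γ * t))) atTop (𝓝 0) :=
    Real.tendsto_exp_neg_atTop_nhds_zero.comp (tendsto_id.const_mul_atTop hγ)
  refine squeeze_zero_norm' (eventually_atTop.2 ⟨0, fun t ht => hS t ht i⟩) ?_
  simpa using h1.const_mul K

end Trajectory

end ExoNet

theorem lemma3 {N r : ℕ}
    (G : ℝ → Digraph (Fin (N + 1))) (a : ℝ → Fin (N + 1) → Fin (N + 1) → ℝ)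
    (hnet : ExoNet.IsCommunicationNetwork G a)
    (hdwell : ExoNet.HasDwellTime G)
    (htree : ExoNet.UniformlyContainsSpanningTree G 0)
    (S₀ : Matrix (Fin r) (Fin r) ℝ)
    (hS₀ : ∀ μ ∈ spectrum ℂ (S₀.map (algebraMap ℝ ℂ)), μ.re = 0)
    (S : Fin (N + 1) → ℝ → Matrix (Fin r) (Fin r) ℝ)
    (w : Fin (N + 1) → ℝ → Fin r → ℝ)
    (hsol : ExoNet.IsExosystemGeneratorTrajectory a S₀ S w) :
    ∀ i : Fin (N + 1), i ≠ 0 →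
      Tendsto (fun t : ℝ => S i t - S₀) atTop (𝓝 0) ∧
      Tendsto (fun t : ℝ => w i t - w 0 t) atTop (𝓝 0) := by
  exact fun i _ => ⟨hsol.tendsto_S_sub hnet hdwell htree i,
    hsol.tendsto_w_sub hnet hdwell htree hS₀ i⟩
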